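/- Notation. Let $\mathcal F$ be the set of all non-empty finite subsets of $\mathbb N$; for $\alpha,\beta\in\mathcal F$ write $\alpha<\beta$ if $\max\alpha<\min\beta$. An IP-ring is a set $\mathcal F^{(1)}=\{\bigcup_{i\in\beta}\alpha_i:\beta\in\mathcal F\}\subseteq\mathcal F$, where $\alpha_1<\alpha_2<\cdots$ is a sequence in $\mathcal F$. For a sequence $(n_i)_{i\in\mathbb N}$ of integers (not necessarily distinct) put $n_\alpha=\sum_{i\in\alpha}n_i$ for $\alpha\in\mathcal F$; the indexed family $A=\{n_\alpha\}_{\alpha\in\mathcal F}$ is the IP-set generated by $(n_i)$. Let $\mathcal G_A$ be the family of all $B\subseteq\mathbb Z$ that contain $\{n_\alpha:\alpha\in\mathcal F^{(1)}\}$ for some IP-ring $\mathcal F^{(1)}$, and let $\mathcal G_A^*$ be the family of all $B\subseteq\mathbb Z$ that meet every member of $\mathcal G_A$. An integral polynomial is a polynomial taking integer values at the integers. For a homeomorphism $T$ of a compact metric space $X$, $(X,T)$ is minimal if $X$ has no proper non-empty closed subset $C$ with $T^kC\subseteq C$ for all $k\in\mathbb Z$, and $(X,T)$ is mixing along $A$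 if for all non-empty open $U,V\subseteq X$ and every IP-ring $\mathcal F^{(1)}$ there is $\alpha\in\mathcal F^{(1)}$ with $U\cap T^{-n_\alpha}V\neq\emptyset$. Theorem 3.3. Let $A=\{n_\alpha\}_{\alpha\in\mathcal F}$ be an IP-set of integers, let $d\in\mathbb N$, and let $p_1,\dots,p_d$ be integral polynomials such that no $p_i$ and no $p_i-p_j$ with $i\neq j$ is constant. Let $X$ be a compact metric space and $T:X\to X$ a homeomorphism such that $(X,T)$ is minimal and $(X,T^k)$ is mixing along $A$ for every $k\in\mathbb Z\setminus\{0\}$. Then $(X,T)$ is $\{T^{p_1(n)},\dots,T^{p_d(n)}\}_\Delta$-$\mathcal G_A^*$-transitive, that is: for all non-empty open sets $U,V_1,\dots,V_d\subseteq X$, every $\alpha_0\in\mathcal F$ and every IP-ring $\mathcal F^{(1)}$ there is $\alpha\in\mathcal F^{(1)}$ with $\alpha>\alpha_0$ and $$U\cap T^{-p_1(n_\alpha)}V_1\cap\cdots\cap T^{-p_d(n_\alpha)}V_d\neq\emptyset;$$ equivalently, for all non-empty open sets $U,V_1,\dots,V_d\subseteq X$, $$\{n\in\mathbb Z: U\cap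 T^{-p_1(n)}V_1\cap\cdots\cap T^{-p_d(n)}V_d\neq\emptyset\}\in\mathcal G_A^*.$$ -/

import Mathlib

namespace IPMixing

/-- `α < β` for finite sets of indices: every element of `α` is smaller than every element of `β`
(that is, `max α < min β` for nonempty `α`, `β`). -/
def Before (α β : Finset ℕ) : Prop := ∀ a ∈ α, ∀ b ∈ β, a < b

/-- An IP-ring: the collection of all unions `⋃ i ∈ β, a i`, `β` finite and nonempty, for a
sequence of nonempty finite sets `a 0 < a 1 < a 2 < ⋯`. -/
def IsIPRing (R : Set (Finset ℕ)) : Prop :=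
  ∃ a : ℕ → Finset ℕ, (∀ i, (a i).Nonempty) ∧ (∀ i, Before (a i) (a (i + 1))) ∧
    R = {α | ∃ β : Finset ℕ, β.Nonempty ∧ α = β.biUnion a}

/-- `n_α = ∑ i ∈ α, n i`. The IP-set generated by the sequence `n` is the family of all `n_α`,
`α` finite and nonempty. -/
def ipSum (n : ℕ → ℤ) (α : Finset ℕ) : ℤ := ∑ i ∈ α, n i

/-- The family `𝒢_A` of the IP-set `A = {n_α}`: all sets of integers that contain
`{n_α : α ∈ R}` for some IP-ring `R`. -/
def ipFamily (n : ℕ → ℤ) : Set (Set ℤ) :=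
  {B | ∃ R : Set (Finset ℕ), IsIPRing R ∧ ipSum n '' R ⊆ B}

/-- The dual `𝒢*` of a family of sets of integers. -/
def dualFamily (G : Set (Set ℤ)) : Set (Set ℤ) :=
  {B | ∀ C ∈ G, (B ∩ C).Nonempty}

variable {X : Type*} [TopologicalSpace X]

/-- `(X, T)` is minimal: `X` has no proper nonempty closed invariant subset (invariance is under
the `ℤ`-action generated by the homeomorphism `T`). -/
def IsMinimalSystem (T : X ≃ₜ X) : Prop :=
  ∀ C : Set X, IsClosed C → C.Nonempty → (∀ k : ℤ, ∀ x ∈ C, (T ^ k) x ∈ C) → C = Set.univ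

/-- `(X, T)` is mixing along the IP-set generated by `n`. -/
def IsMixingAlong (T : X ≃ₜ X) (n : ℕ → ℤ) : Prop :=
  ∀ U V : Set X, IsOpen U → U.Nonempty → IsOpen V → V.Nonempty →
    ∀ R : Set (Finset ℕ), IsIPRing R →
      ∃ α ∈ R, (U ∩ (T ^ ipSum n α) ⁻¹' V).Nonempty

/-- The `{g_1, …, g_d}_Δ`-`𝒢_A^*`-transitivity of a system, for the IP-set `A` generated by `n`:
in every IP-ring and beyond every `α₀` there is `α` such that
`U ∩ g_1(n_α)⁻¹ V_1 ∩ ⋯ ∩ g_d(n_α)⁻¹ V_d` is nonempty. -/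
def IsDeltaTransitive {d : ℕ} (g : Fin d → ℤ → (X ≃ₜ X)) (n : ℕ → ℤ) : Prop :=
  ∀ (U : Set X) (V : Fin d → Set X), IsOpen U → U.Nonempty →
    (∀ i, IsOpen (V i)) → (∀ i, (V i).Nonempty) →
    ∀ α₀ : Finset ℕ, α₀.Nonempty → ∀ R : Set (Finset ℕ), IsIPRing R →
      ∃ α ∈ R, Before α₀ α ∧ (U ∩ ⋂ i, (g i (ipSum n α)) ⁻¹' V i).Nonempty

/-- An integral polynomial, viewed as a function `ℤ → ℤ`: one that is given by a polynomial with
rational coefficients (a polynomial with integer values at the integers has such coefficients). -/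
def IsIntegralPolynomial (p : ℤ → ℤ) : Prop :=
  ∃ P : Polynomial ℚ, ∀ m : ℤ, (p m : ℚ) = P.eval (m : ℚ)

/-- The function `p` is constant. -/
def IsConstant (p : ℤ → ℤ) : Prop := ∃ c : ℤ, ∀ m : ℤ, p m = c

end IPMixing

/-!
# Transitivity along polynomials for minimal systems mixing along an IP-set

Call a family of finite index sets IP* if it meets every IP-ring. By Hindman's theorem a finite
intersection of IP* families is IP* (`IsIPStar.inter`), so finitely many conditions on `α`, each of
which can be met in every IP-ring, can be met simultaneously. The theorem says that, for given open
sets, the good `α` form an IP* family. After subtraction of constant terms the polynomials are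
pairwise distinct, nonzero and vanish at `0`.

The proof is PET induction (`isIPStar_nonempty_inter`). By minimality, finitely many translates of
`U` cover `X`: there is a finite `t` such that every `x` has `T^s x ∈ U` for some `s ∈ t`. For
each `s ∈ t` choose an auxiliary time `n_s = n_{A s}` in the given IP-ring. With `m = n_α`, `α > A
s`, one has `n_{A s ∪ α} = n_s + m`, and the point `y = T^s x` satisfies `T^{q(n_s + m)} y =
T^{q(n_s) + s} T^{q(n_s + m) - q(n_s)} x`. Hence it is enough to find `m` and `x` such that the
increments `m ↦ q(n_s + m) - q(n_s)`, for all `q` and all `s ∈ t`, carry `x` into prescribed open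
sets; the `s` with `T^s x ∈ U` is selected only afterwards. Increments of a linear `q` do not
depend on `s`, so for linear `q` one target set has to serve all `s ∈ t`: this is where mixing
enters. Increments of the nonlinear `q` are distinct if the times `n_s` are generic
(`exists_generic_times`), so there the target may depend on `s`. Finally, moving `x` by the
increment of least degree replaces the family by the differences with that increment, which has
smaller weight (`petWeight_sub_lt`), and the induction hypothesis applies.
-/

namespace IPMixing

open Polynomial

/-! ### IP-rings and Hindman's theorem -/

theorem Before.disjoint {α β : Finset ℕ} (h : Before α β) : Disjoint α β :=
  Finset.disjoint_left.2 fun x hx hx' => lt_irrefl _ (h x hx x hx')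

theorem Before.trans {α β γ : Finset ℕ} (hβ : β.Nonempty) (h₁ : Before α β) (h₂ : Before β γ) :
    Before α γ := fun a ha c hc =>
  let ⟨b, hb⟩ := hβ
  (h₁ a ha b hb).trans (h₂ b hb c hc)

theorem ipSum_union (n : ℕ → ℤ) {α β : Finset ℕ} (h : Before α β) :
    ipSum n (α ∪ β) = ipSum n α + ipSum n β :=
  Finset.sum_union h.disjoint

/-- A sequence `a 0 < a 1 < ⋯` of nonempty finite sets, as in the definition of an IP-ring. -/
def IsBlockSeq (a : ℕ → Finset ℕ) : Prop :=
  (∀ i, (a i).Nonempty) ∧ ∀ i, Before (a i) (a (i + 1))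

/-- The IP-ring generated by `a`. -/
def ringOf (a : ℕ → Finset ℕ) : Set (Finset ℕ) :=
  {α | ∃ β : Finset ℕ, β.Nonempty ∧ α = β.biUnion a}

theorem IsBlockSeq.isIPRing {a : ℕ → Finset ℕ} (ha : IsBlockSeq a) : IsIPRing (ringOf a) :=
  ⟨a, ha.1, ha.2, rfl⟩

theorem IsBlockSeq.before {a : ℕ → Finset ℕ} (ha : IsBlockSeq a) {i j : ℕ} (hij : i < j) :
    Before (a i) (a j) := by
  induction j, hij using Nat.le_induction with
  | base => exact ha.2 i
  | succ j _ ih => exact ih.trans (ha.1 j) (ha.2 j)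

theorem IsBlockSeq.le_of_mem {a : ℕ → Finset ℕ} (ha : IsBlockSeq a) {i x : ℕ} (hx : x ∈ a i) :
    i ≤ x := by
  induction i generalizing x with
  | zero => exact Nat.zero_le x
  | succ i ih =>
    obtain ⟨y, hy⟩ := ha.1 i
    exact (ih hy).trans_lt (ha.2 i y hy x hx)

theorem IsBlockSeq.shift {a : ℕ → Finset ℕ} (ha : IsBlockSeq a) (k : ℕ) :
    IsBlockSeq fun i => a (i + k) :=
  ⟨fun i => ha.1 _, fun i => ha.before (by omega)⟩

theorem IsIPRing.nonempty {R : Set (Finset ℕ)} (hR : IsIPRing R) : R.Nonempty := by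
  obtain ⟨a, _, _, rfl⟩ := hR
  exact ⟨a 0, {0}, by simp, by simp⟩

theorem IsIPRing.union_mem {R : Set (Finset ℕ)} (hR : IsIPRing R) {α β : Finset ℕ}
    (hα : α ∈ R) (hβ : β ∈ R) : α ∪ β ∈ R := by
  obtain ⟨a, _, _, rfl⟩ := hR
  obtain ⟨s, hs, rfl⟩ := hα
  obtain ⟨t, _, rfl⟩ := hβ
  exact ⟨s ∪ t, hs.mono Finset.subset_union_left, by rw [Finset.union_biUnion]⟩

theorem IsIPRing.exists_before {R : Set (Finset ℕ)} (hR : IsIPRing R) (α₀ : Finset ℕ) :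
    ∃ α ∈ R, Before α₀ α := by
  obtain ⟨a, h₁, h₂, rfl⟩ := hR
  refine ⟨a (α₀.sup id + 1), ⟨{α₀.sup id + 1}, by simp, by simp⟩, fun x hx y hy => ?_⟩
  have h3 : x ≤ α₀.sup id := Finset.le_sup (f := id) hx
  have h4 := IsBlockSeq.le_of_mem ⟨h₁, h₂⟩ hy
  omega

/-- Finite sets under the partial operation `α, β ↦ α ∪ β`, defined when `α < β` and made total by
an absorbing element `none`. Finite products of a block sequence are the members of its IP-ring,
and a sequence of nonempty sets none of whose finite products is `none` is a block sequence; thus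
Hindman's theorem for this semigroup is a statement about IP-rings. -/
inductive BlockSemigroup : Type
  | block (α : Finset ℕ)
  | none

namespace BlockSemigroup

open Classical in
/-- The product of two elements: the union if the two sets are in order. -/
noncomputable def mul : BlockSemigroup → BlockSemigroup → BlockSemigroup
  | block α, block β => if Before α β then block (α ∪ β) else none
  | _, _ => none

theorem mul_block {α β : Finset ℕ} (h : Before α β) :
    mul (block α) (block β) = block (α ∪ β) := if_pos h

theorem mul_block_of_not {α β : Finset ℕ} (h : ¬ Before α β) :
    mul (block α) (block β) = none := if_neg h

theorem mul_none (x : BlockSemigroup) : mul x none = none := by cases x <;> rfl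

theorem none_mul (x : BlockSemigroup) : mul none x = none := by cases x <;> rfl

theorem before_union_left {α β γ : Finset ℕ} :
    Before (α ∪ β) γ ↔ Before α γ ∧ Before β γ := by
  simp only [Before, Finset.mem_union]
  grind

theorem before_union_right {α β γ : Finset ℕ} :
    Before α (β ∪ γ) ↔ Before α β ∧ Before α γ := by
  simp only [Before, Finset.mem_union]
  grind

noncomputable instance : Semigroup BlockSemigroup where
  mul := mul
  mul_assoc x y z := by
    change mul (mul x y) z = mul x (mul y z)
    rcases x with α | _
    swap; · simp only [none_mul]
    rcases y with β | _
    swap; · simp only [none_mul, mul_none]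
    rcases z with γ | _
    swap; · simp only [mul_none]
    by_cases h₁ : Before α β <;> by_cases h₂ : Before β γ
    · by_cases h₃ : Before α γ
      · rw [mul_block h₁, mul_block h₂, mul_block (before_union_left.2 ⟨h₃, h₂⟩),
          mul_block (before_union_right.2 ⟨h₁, h₃⟩), Finset.union_assoc]
      · rw [mul_block h₁, mul_block h₂, mul_block_of_not fun h => h₃ (before_union_left.1 h).1,
          mul_block_of_not fun h => h₃ (before_union_right.1 h).2]
    · rw [mul_block h₁, mul_block_of_not h₂, mul_none,
        mul_block_of_not fun h => h₂ (before_union_left.1 h).2]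
    · rw [mul_block h₂, mul_block_of_not h₁, none_mul,
        mul_block_of_not fun h => h₁ (before_union_right.1 h).1]
    · rw [mul_block_of_not h₁, mul_block_of_not h₂, none_mul, mul_none]

theorem before_of_mul_ne_none {α β : Finset ℕ}
    (h : block α * block β ≠ none) :
    Before α β := by
  by_contra h'
  exact h (mul_block_of_not h')

/-- A sequence of finite sets as a stream in the semigroup. -/
def stream (a : ℕ → Finset ℕ) : Stream' BlockSemigroup := fun i => block (a i)

theorem mem_ringOf_of_mem_FP {s : Stream' BlockSemigroup} {m : BlockSemigroup}
    (hm : m ∈ Hindman.FP s) {a : ℕ → Finset ℕ} (ha : IsBlockSeq a) (hs : s = stream a) :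
    ∃ α ∈ ringOf a, m = block α := by
  induction hm generalizing a with
  | head' s => subst hs; exact ⟨a 0, ⟨{0}, by simp, by simp⟩, rfl⟩
  | tail' s m _ ih =>
    subst hs
    obtain ⟨_, ⟨β, hβ, rfl⟩, rfl⟩ := ih (ha.shift 1) rfl
    exact ⟨_, ⟨β.image (· + 1), hβ.image _, by rw [Finset.image_biUnion]⟩, rfl⟩
  | cons' s m _ ih =>
    subst hs
    obtain ⟨_, ⟨β, hβ, rfl⟩, rfl⟩ := ih (ha.shift 1) rfl
    refine ⟨_, ⟨insert 0 (β.image (· + 1)), by simp, ?_⟩, mul_block ?_⟩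
    · rw [Finset.biUnion_insert, Finset.image_biUnion]
    · intro x hx y hy
      obtain ⟨i, _, hy⟩ := Finset.mem_biUnion.1 hy
      exact ha.before (Nat.succ_pos i) x hx y hy

theorem mem_FP_of_mem_ringOf {a : ℕ → Finset ℕ} (ha : IsBlockSeq a) {α : Finset ℕ}
    (hα : α ∈ ringOf a) : block α ∈ Hindman.FP (stream a) := by
  obtain ⟨β, hβ, rfl⟩ := hα
  suffices h : ∀ k, (∀ x ∈ β, k ≤ x) →
      block (β.biUnion a) ∈ Hindman.FP ((stream a).drop k) from
    h 0 fun x _ => Nat.zero_le x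
  induction β using Finset.induction_on_min with
  | empty => simp at hβ
  | insert i s hi ih =>
    intro k hk
    have hdrop : (stream a).drop i = ((stream a).drop k).drop (i - k) := by
      rw [Stream'.drop_drop, Nat.add_sub_cancel' (hk i (by simp))]
    suffices h : block ((insert i s).biUnion a) ∈ Hindman.FP ((stream a).drop i) by
      rw [hdrop] at h
      exact Hindman.FP_drop_subset_FP _ _ h
    rcases s.eq_empty_or_nonempty with rfl | hs
    · have := Hindman.FP.head ((stream a).drop i)
      rw [Stream'.head_drop] at this
      simpa [stream, Stream'.get] using this
    · have h := Hindman.FP.cons ((stream a).drop i) _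
        (by rw [Stream'.tail_drop']; exact ih hs (i + 1) hi)
      rw [Stream'.head_drop] at h
      change mul (block (a i)) (block (s.biUnion a)) ∈ _ at h
      rwa [mul_block, ← Finset.biUnion_insert] at h
      intro x hx y hy
      obtain ⟨j, hj, hy⟩ := Finset.mem_biUnion.1 hy
      exact ha.before (hi j hj) x hx y hy

end BlockSemigroup

/-- The IP-ring form of Hindman's theorem. -/
theorem IsIPRing.exists_subring {R : Set (Finset ℕ)} (hR : IsIPRing R) (D : Set (Finset ℕ)) :
    ∃ R' ⊆ R, IsIPRing R' ∧ (R' ⊆ D ∨ R' ⊆ Dᶜ) := by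
  obtain ⟨a, h₁, h₂, rfl⟩ := hR
  have ha : IsBlockSeq a := ⟨h₁, h₂⟩
  change ∃ R' ⊆ ringOf a, _
  let emb : Finset ℕ → BlockSemigroup := BlockSemigroup.block
  have hemb : ∀ {α β}, emb α = emb β → α = β := fun h => BlockSemigroup.block.inj h
  obtain ⟨c, hc, s, hs⟩ := Hindman.FP_partition_regular (BlockSemigroup.stream a)
    {emb '' (ringOf a ∩ D), emb '' (ringOf a ∩ Dᶜ)} (by simp) (by
      intro m hm
      obtain ⟨α, hα, rfl⟩ := BlockSemigroup.mem_ringOf_of_mem_FP hm ha rfl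
      by_cases hD : α ∈ D
      · exact ⟨_, Or.inl rfl, α, ⟨hα, hD⟩, rfl⟩
      · exact ⟨_, Or.inr rfl, α, ⟨hα, hD⟩, rfl⟩)
  obtain ⟨E, hE, hcE⟩ : ∃ E : Set (Finset ℕ), (E = D ∨ E = Dᶜ) ∧ c = emb '' (ringOf a ∩ E) := by
    rcases hc with h | h
    · exact ⟨D, Or.inl rfl, h⟩
    · exact ⟨Dᶜ, Or.inr rfl, h⟩
  subst hcE
  choose b hb hbs using fun i => hs (Hindman.FP.singleton s i)
  have hsb : s = BlockSemigroup.stream b := by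
    funext i
    exact (hbs i).symm
  have hbB : IsBlockSeq b := by
    refine ⟨fun i => ?_, fun i => ?_⟩
    · obtain ⟨β, ⟨j, hj⟩, h⟩ := (hb i).1
      obtain ⟨x, hx⟩ := h₁ j
      exact ⟨x, h ▸ Finset.mem_biUnion.2 ⟨j, hj, hx⟩⟩
    · obtain ⟨γ, _, hγ⟩ := hs (Hindman.FP.mul_two s i (i + 1) (Nat.lt_succ_self i))
      rw [← hbs, ← hbs] at hγ
      refine BlockSemigroup.before_of_mul_ne_none fun h => ?_
      exact BlockSemigroup.noConfusion (hγ.trans h)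
  have key : ringOf b ⊆ ringOf a ∩ E := by
    intro α hα
    obtain ⟨γ, hγ, h⟩ := hs (hsb ▸ BlockSemigroup.mem_FP_of_mem_ringOf hbB hα)
    exact hemb h ▸ hγ
  refine ⟨ringOf b, fun α hα => (key hα).1, hbB.isIPRing, ?_⟩
  rcases hE with rfl | rfl
  · exact Or.inl fun α hα => (key hα).2
  · exact Or.inr fun α hα => (key hα).2

/-- A family of finite sets of indices that meets every IP-ring. -/
def IsIPStar (D : Set (Finset ℕ)) : Prop := ∀ R, IsIPRing R → ∃ α ∈ R, α ∈ D

/-- By Hindman's theorem, an IP-ring contains an IP-ring inside `D`, and that one meets `E`. -/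
theorem IsIPStar.inter {D E : Set (Finset ℕ)} (hD : IsIPStar D) (hE : IsIPStar E) :
    IsIPStar (D ∩ E) := by
  intro R hR
  obtain ⟨R', hR', hring, h | h⟩ := hR.exists_subring D
  · obtain ⟨α, hα, hαE⟩ := hE R' hring
    exact ⟨α, hR' hα, h hα, hαE⟩
  · obtain ⟨α, hα, hαD⟩ := hD R' hring
    exact absurd hαD (h hα)

theorem isIPStar_biInter {ι : Type*} (s : Finset ι) {D : ι → Set (Finset ℕ)}
    (hD : ∀ i ∈ s, IsIPStar (D i)) : IsIPStar {α | ∀ i ∈ s, α ∈ D i} := by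
  classical
  induction s using Finset.induction_on with
  | empty =>
    intro R hR
    obtain ⟨α, hα⟩ := hR.nonempty
    exact ⟨α, hα, by simp⟩
  | insert i s _ ih =>
    intro R hR
    obtain ⟨α, hα, h₁, h₂⟩ := ((hD i (by simp)).inter (ih fun j hj => hD j (by simp [hj]))) R hR
    refine ⟨α, hα, fun j hj => ?_⟩
    rcases Finset.mem_insert.1 hj with rfl | hj
    exacts [h₁, h₂ j hj]

theorem isIPStar_forall {ι : Type*} [Finite ι] {D : ι → Set (Finset ℕ)}
    (hD : ∀ i, IsIPStar (D i)) : IsIPStar {α | ∀ i, α ∈ D i} := by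
  have := Fintype.ofFinite ι
  simpa using isIPStar_biInter Finset.univ fun i _ => hD i

theorem isIPStar_before (α₀ : Finset ℕ) : IsIPStar {α | Before α₀ α} :=
  fun _ hR => hR.exists_before α₀

/-! ### Integer-valued polynomials -/

/-- The polynomial takes integer values at the integers. -/
def IsIntegerValued (P : ℚ[X]) : Prop := ∀ m : ℤ, ∃ z : ℤ, P.eval (m : ℚ) = z

/-- The value of an integer-valued polynomial as an integer; the floor is a junk value
otherwise. -/
noncomputable def intEval (P : ℚ[X]) (m : ℤ) : ℤ := ⌊P.eval (m : ℚ)⌋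

theorem IsIntegerValued.cast_intEval {P : ℚ[X]} (hP : IsIntegerValued P) (m : ℤ) :
    (intEval P m : ℚ) = P.eval (m : ℚ) := by
  obtain ⟨z, hz⟩ := hP m
  rw [intEval, hz, Int.floor_intCast]

theorem IsIntegerValued.sub {P Q : ℚ[X]} (hP : IsIntegerValued P) (hQ : IsIntegerValued Q) :
    IsIntegerValued (P - Q) := fun m =>
  ⟨intEval P m - intEval Q m, by
    rw [eval_sub, Int.cast_sub, hP.cast_intEval, hQ.cast_intEval]⟩

theorem intEval_sub {P Q : ℚ[X]} (hP : IsIntegerValued P) (hQ : IsIntegerValued Q) (m : ℤ) :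
    intEval (P - Q) m = intEval P m - intEval Q m := by
  have : ((intEval (P - Q) m : ℤ) : ℚ) = ((intEval P m - intEval Q m : ℤ) : ℚ) := by
    rw [(hP.sub hQ).cast_intEval, Int.cast_sub, hP.cast_intEval, hQ.cast_intEval, eval_sub]
  exact_mod_cast this

/-- The difference polynomial `x ↦ P (x + a) - P a`. -/
noncomputable def increment (P : ℚ[X]) (a : ℤ) : ℚ[X] :=
  taylor (a : ℚ) P - C (P.eval (a : ℚ))

theorem increment_eval (P : ℚ[X]) (a : ℤ) (x : ℚ) :
    (increment P a).eval x = P.eval (x + a) - P.eval (a : ℚ) := by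
  simp [increment, taylor_eval]

theorem increment_eval_zero (P : ℚ[X]) (a : ℤ) : (increment P a).eval 0 = 0 := by
  simp [increment_eval]

theorem IsIntegerValued.increment {P : ℚ[X]} (hP : IsIntegerValued P) (a : ℤ) :
    IsIntegerValued (increment P a) := fun m =>
  ⟨intEval P (m + a) - intEval P a, by
    rw [increment_eval, Int.cast_sub, hP.cast_intEval, hP.cast_intEval, Int.cast_add]⟩

theorem intEval_increment {P : ℚ[X]} (hP : IsIntegerValued P) (a m : ℤ) :
    intEval (increment P a) m = intEval P (m + a) - intEval P a := by
  have : ((intEval (increment P a) m : ℤ) : ℚ) =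
      ((intEval P (m + a) - intEval P a : ℤ) : ℚ) := by
    rw [(hP.increment a).cast_intEval, Int.cast_sub, hP.cast_intEval, hP.cast_intEval,
      increment_eval, Int.cast_add]
  exact_mod_cast this

theorem natDegree_increment (P : ℚ[X]) (a : ℤ) :
    (increment P a).natDegree = P.natDegree := by
  rw [increment, natDegree_sub_C, natDegree_taylor]

theorem natDegree_pos_of_eval_zero {P : ℚ[X]} (h0 : P.eval 0 = 0) (hne : P ≠ 0) :
    0 < P.natDegree := by
  rw [Nat.pos_iff_ne_zero]
  intro h
  obtain ⟨c, rfl⟩ := natDegree_eq_zero.1 h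
  simp_all

theorem leadingCoeff_increment {P : ℚ[X]} (hP : 0 < P.natDegree) (a : ℤ) :
    (increment P a).leadingCoeff = P.leadingCoeff := by
  rw [leadingCoeff, natDegree_increment, increment, coeff_sub, coeff_taylor_natDegree,
    coeff_C_of_ne_zero hP.ne', sub_zero]

/-- If two increments agree for `a ≠ b`, then `P` minus a linear function is periodic, hence
constant. -/
theorem increment_injective {P : ℚ[X]} (hP : 1 < P.natDegree) :
    Function.Injective (increment P) := by
  intro a b hab
  by_contra hne
  have hh : (a : ℚ) - b ≠ 0 := sub_ne_zero.2 (by exact_mod_cast hne)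
  set h : ℚ := a - b with hh_def
  set c : ℚ := P.eval (a : ℚ) - P.eval (b : ℚ) with hc
  have hstep : ∀ x : ℚ, P.eval (x + h) = P.eval x + c := fun x => by
    have := congrArg (eval (x - b)) hab
    rw [increment_eval, increment_eval] at this
    rw [show x - b + a = x + h by rw [hh_def]; ring, sub_add_cancel] at this
    rw [hc]; linarith
  have hk : ∀ k : ℕ, P.eval (k * h) = P.eval 0 + k * c := fun k => by
    induction k with
    | zero => simp
    | succ k ih =>
      rw [Nat.cast_succ, add_mul, one_mul, hstep, ih]; ring
  have hzero : P - (C (c / h) * X + C (P.eval 0)) = 0 := by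
    refine eq_zero_of_infinite_isRoot _ (Set.Infinite.mono ?_
      (Set.infinite_range_of_injective (f := fun k : ℕ => (k : ℚ) * h) fun k l hkl => ?_))
    · rintro _ ⟨k, rfl⟩
      simp only [Set.mem_ofPred_eq, IsRoot, eval_sub, eval_add, eval_mul, eval_C, eval_X, hk]
      field_simp
      ring
    · exact_mod_cast mul_right_cancel₀ hh hkl
  have := natDegree_linear_le (a := c / h) (b := P.eval 0)
  rw [← sub_eq_zero.1 hzero] at this
  omega

/-- For a fixed increment `a`, the polynomial is recovered up to a constant. -/
theorem eq_of_increment_eq {P Q : ℚ[X]} (hP : P.eval 0 = 0) (hQ : Q.eval 0 = 0) {a : ℤ}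
    (h : increment P a = increment Q a) : P = Q := by
  have h1 : taylor (a : ℚ) (P - Q) = C (P.eval (a : ℚ) - Q.eval (a : ℚ)) := by
    rw [map_sub, C_sub]
    exact sub_eq_sub_iff_sub_eq_sub.1 h
  have h2 : P - Q = C (P.eval (a : ℚ) - Q.eval (a : ℚ)) :=
    taylor_injective (a : ℚ) (by rw [h1, taylor_C])
  have h3 := congrArg (eval 0) h2
  rw [eval_sub, hP, hQ, sub_zero, eval_C] at h3
  rw [← h3, C_0] at h2
  exact sub_eq_zero.1 h2

theorem exists_intEval_eq_mul {P : ℚ[X]} (hP : IsIntegerValued P) (h0 : P.eval 0 = 0)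
    (hdeg : P.natDegree = 1) : ∃ c : ℤ, c ≠ 0 ∧ ∀ m, intEval P m = c * m := by
  obtain ⟨a, ha, b, rfl⟩ := natDegree_eq_one.1 hdeg
  have hb : b = 0 := by simpa using h0
  subst hb
  obtain ⟨c, hc⟩ := hP 1
  have hc' : a = c := by simpa using hc
  subst hc'
  refine ⟨c, by exact_mod_cast ha, fun m => ?_⟩
  have := hP.cast_intEval m
  rw [eval_add, eval_mul, eval_C, eval_X, eval_C, add_zero] at this
  exact_mod_cast this

/-! ### The weight of a family of polynomials -/

/-- The pairs (degree, leading coefficient) that occur in a family of polynomials. -/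
noncomputable def leadingData {ι : Type*} [Finite ι] (q : ι → ℚ[X]) : Finset (ℕ × ℚ) :=
  (Set.finite_range fun i => ((q i).natDegree, (q i).leadingCoeff)).toFinset

/-- The weight of a family of polynomials: the multiset of the degrees, where a degree counts as
often as there are distinct leading coefficients in that degree. Weights are compared in the
Dershowitz–Manna order, which here is the lexicographic order of PET induction. -/
noncomputable def petWeight {ι : Type*} [Finite ι] (q : ι → ℚ[X]) : Multiset ℕ :=
  (leadingData q).val.map Prod.fst

theorem mem_leadingData {ι : Type*} [Finite ι] {q : ι → ℚ[X]} {x : ℕ × ℚ} :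
    x ∈ leadingData q ↔ ∃ i, ((q i).natDegree, (q i).leadingCoeff) = x := by
  simp [leadingData]

/-- Subtracting a member of minimal degree `k` lowers the weight: the leading data in degrees above
`k` stay, those in degree `k` are translated and lose one element, and the rest has degree
below `k`. -/
theorem petWeight_sub_lt {κ : Type*} [Finite κ] {q : κ → ℚ[X]} (hq : Function.Injective q)
    {o : κ} (ho : ∀ i, (q o).natDegree ≤ (q i).natDegree) :
    Multiset.IsDershowitzMannaLT (petWeight fun i : {i // i ≠ o} => q i - q o) (petWeight q) := by
  classical
  set k := (q o).natDegree with hk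
  set c := (q o).leadingCoeff with hc
  set L := leadingData q with hL
  set L' := leadingData fun i : {i // i ≠ o} => q i - q o with hL'
  let φ : ℕ × ℚ → ℕ × ℚ := fun x => if x.1 = k then (x.1, x.2 + c) else x
  have hφ1 : ∀ x, (φ x).1 = x.1 := fun x => by
    simp only [φ]; split_ifs <;> rfl
  have hφ : Function.Injective φ := by
    intro x y hxy
    have h1 : x.1 = y.1 := by rw [← hφ1 x, ← hφ1 y, hxy]
    simp only [φ] at hxy
    rw [h1] at hxy
    split_ifs at hxy
    · exact Prod.ext h1 (add_right_cancel (Prod.ext_iff.1 hxy).2)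
    · exact hxy
  have hsub : (L'.filter fun x => ¬ x.1 < k).image φ ⊆ L.erase (k, c) := by
    intro y hy
    obtain ⟨x, hx, rfl⟩ := Finset.mem_image.1 hy
    obtain ⟨hxL, hxk⟩ := Finset.mem_filter.1 hx
    obtain ⟨⟨i, hi⟩, rfl⟩ := mem_leadingData.1 hxL
    simp only at hxk
    rw [Finset.mem_erase]
    rcases (ho i).lt_or_eq with hlt | heq
    · have h1 : (q i - q o).natDegree = (q i).natDegree :=
        natDegree_sub_eq_left_of_natDegree_lt hlt
      have h2 : (q i - q o).leadingCoeff = (q i).leadingCoeff :=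
        leadingCoeff_sub_of_degree_lt (degree_lt_degree hlt)
      simp only [φ, h1, h2, if_neg hlt.ne']
      exact ⟨fun h => hlt.ne' (Prod.ext_iff.1 h).1, mem_leadingData.2 ⟨i, rfl⟩⟩
    · have h1 : (q i - q o).natDegree = k := by
        refine le_antisymm ?_ (not_lt.1 hxk)
        exact (natDegree_sub_le _ _).trans (by rw [← heq, max_self])
      have h2 : (q i - q o).leadingCoeff = (q i).leadingCoeff - c := by
        rw [leadingCoeff, h1, coeff_sub, hc, leadingCoeff, leadingCoeff, ← heq]
      have h3 : (q i - q o).leadingCoeff ≠ 0 :=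
        leadingCoeff_ne_zero.2 (sub_ne_zero.2 fun h => hi (hq h))
      simp only [φ, h1, if_true, h2, sub_add_cancel]
      refine ⟨fun h => h3 ?_, mem_leadingData.2 ⟨i, by rw [← heq]⟩⟩
      rw [h2, sub_eq_zero]
      exact (Prod.ext_iff.1 h).2
  have hle : (L'.filter fun x => ¬ x.1 < k).val.map Prod.fst ≤
      (L.erase (k, c)).val.map Prod.fst := by
    have h := Multiset.map_le_map (f := Prod.fst) (Finset.val_le_iff.2 hsub)
    rw [Finset.image_val_of_injOn hφ.injOn, Multiset.map_map] at h
    rwa [show Prod.fst ∘ φ = Prod.fst from funext hφ1] at h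
  obtain ⟨Z, hZ⟩ := Multiset.le_iff_exists_add.1 hle
  refine ⟨(L'.filter fun x => ¬ x.1 < k).val.map Prod.fst,
    (L'.filter fun x => x.1 < k).val.map Prod.fst, Z + {k}, by simp, ?_, ?_, ?_⟩
  · rw [petWeight, ← hL', ← Multiset.map_add, add_comm, Finset.filter_val, Finset.filter_val,
      Multiset.filter_add_not]
  · rw [← add_assoc, ← hZ, petWeight, ← hL]
    have hmem : (k, c) ∈ L := mem_leadingData.2 ⟨o, rfl⟩
    rw [← Finset.insert_erase hmem, Finset.insert_val_of_notMem (Finset.notMem_erase _ _),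
      Multiset.map_cons, Finset.erase_insert (Finset.notMem_erase _ _), ← Multiset.singleton_add,
      add_comm]
  · intro y hy
    obtain ⟨x, hx, rfl⟩ := Multiset.mem_map.1 hy
    exact ⟨k, by simp, (Finset.mem_filter.1 hx).2⟩

/-! ### Transitivity along polynomials -/

theorem zpow_add_apply {X : Type*} [TopologicalSpace X] (T : X ≃ₜ X) (a b : ℤ) (x : X) :
    (T ^ (a + b)) x = (T ^ a) ((T ^ b) x) := by
  rw [zpow_add]; rfl

theorem zpow_neg_apply {X : Type*} [TopologicalSpace X] (T : X ≃ₜ X) (a : ℤ) (x : X) :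
    (T ^ a) ((T ^ (-a)) x) = x := by
  rw [← zpow_add_apply, add_neg_cancel]; rfl

theorem preimage_zpow_nonempty {X : Type*} [TopologicalSpace X] (T : X ≃ₜ X) (a : ℤ) {V : Set X}
    (hV : V.Nonempty) : ((T ^ a) ⁻¹' V).Nonempty :=
  hV.preimage (T ^ a).surjective

/-- In a minimal compact system, finitely many translates of a nonempty open set cover the
space. -/
theorem IsMinimalSystem.exists_finset_cover {X : Type*} [TopologicalSpace X] [CompactSpace X]
    {T : X ≃ₜ X} (hmin : IsMinimalSystem T) {U : Set X} (hU : IsOpen U) (hne : U.Nonempty) :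
    ∃ t : Finset ℤ, ∀ x, ∃ s ∈ t, (T ^ s) x ∈ U := by
  have hcover : ∀ x, ∃ s : ℤ, (T ^ s) x ∈ U := by
    by_contra! h
    obtain ⟨x, hx⟩ := h
    have hopen : IsOpen (⋃ s : ℤ, (T ^ s) ⁻¹' U) :=
      isOpen_iUnion fun s => hU.preimage (T ^ s).continuous
    have huniv := hmin _ hopen.isClosed_compl ⟨x, by simpa using hx⟩ (by
      intro k y hy hy'
      obtain ⟨s, hs⟩ := Set.mem_iUnion.1 hy'
      refine hy (Set.mem_iUnion.2 ⟨s + k, ?_⟩)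
      rwa [Set.mem_preimage, zpow_add_apply])
    obtain ⟨u, hu⟩ := hne
    have : u ∈ (⋃ s : ℤ, (T ^ s) ⁻¹' U)ᶜ := huniv ▸ Set.mem_univ u
    exact this (Set.mem_iUnion.2 ⟨0, hu⟩)
  obtain ⟨t, ht⟩ := isCompact_univ.elim_finite_subcover (fun s : ℤ => (T ^ s) ⁻¹' U)
    (fun s => hU.preimage (T ^ s).continuous)
    (fun x _ => let ⟨s, hs⟩ := hcover x; Set.mem_iUnion.2 ⟨s, hs⟩)
  refine ⟨t, fun x => ?_⟩
  obtain ⟨s, hs, hx⟩ := Set.mem_iUnion₂.1 (ht (Set.mem_univ x))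
  exact ⟨s, hs, hx⟩

/-- If `n_α` were constant on an IP-ring, the constant would be `0` by additivity, which mixing
excludes; by Hindman's theorem, finitely many values can then be avoided at once. -/
theorem IsMixingAlong.isIPStar_notMem {X : Type*} [TopologicalSpace X] [T2Space X] [Nontrivial X]
    {T : X ≃ₜ X} {n : ℕ → ℤ} (hmix : IsMixingAlong T n) {F : Set ℤ} (hF : F.Finite) :
    IsIPStar {α | ipSum n α ∉ F} := by
  have key : ∀ c, IsIPStar {α | ipSum n α ≠ c} := by
    intro c R hR
    by_contra! h
    have h' : ∀ α ∈ R, ipSum n α = c := fun α hα => by simpa using h α hα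
    have hc : c = 0 := by
      obtain ⟨a, h₁, h₂, rfl⟩ := id hR
      have h0 : a 0 ∈ ringOf a := ⟨{0}, by simp, by simp⟩
      have h1 : a 1 ∈ ringOf a := ⟨{1}, by simp, by simp⟩
      have := h' _ (hR.union_mem h0 h1)
      rw [ipSum_union n (h₂ 0), h' _ h0, h' _ h1] at this
      omega
    obtain ⟨x, y, hxy⟩ := exists_pair_ne X
    obtain ⟨U, V, hU, hV, hx, hy, hd⟩ := t2_separation hxy
    obtain ⟨α, hα, z, hzU, hzV⟩ := hmix U V hU ⟨x, hx⟩ hV ⟨y, hy⟩ R hR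
    rw [h' α hα, hc] at hzV
    exact Set.disjoint_left.1 hd hzU hzV
  intro R hR
  obtain ⟨α, hα, h⟩ := isIPStar_biInter hF.toFinset (fun c _ => key c) R hR
  exact ⟨α, hα, fun hmem => h _ (hF.mem_toFinset.2 hmem) rfl⟩

/-- The choice of the auxiliary times `n_{A s}`, one for each `s ∈ t`. For the linear members of the
family, a single open set `W i` is carried into `V i` by all the maps
`T ^ (q i (n_{A s}) + s)`; for the nonlinear members, the times are generic, in that all
the increments are distinct polynomials. -/
theorem exists_generic_times {X : Type*} [TopologicalSpace X] [T2Space X] [Nontrivial X]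
    {T : X ≃ₜ X} {n : ℕ → ℤ} (hmix : ∀ k : ℤ, k ≠ 0 → IsMixingAlong (T ^ k) n)
    {ι : Type} [Finite ι] {q : ι → ℚ[X]} (hq : Function.Injective q)
    (hint : ∀ i, IsIntegerValued (q i)) (h0 : ∀ i, (q i).eval 0 = 0) (hne : ∀ i, q i ≠ 0)
    {V : ι → Set X} (hV : ∀ i, IsOpen (V i)) (hVne : ∀ i, (V i).Nonempty)
    {R : Set (Finset ℕ)} (hR : IsIPRing R) (t : Finset ℤ) :
    ∃ (A : ℤ → Finset ℕ) (W : ι → Set X), (∀ s ∈ t, A s ∈ R) ∧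
      (∀ i, IsOpen (W i) ∧ (W i).Nonempty) ∧
      (∀ s ∈ t, ∀ i, (q i).natDegree = 1 → ∀ x ∈ W i,
        (T ^ (intEval (q i) (ipSum n (A s)) + s)) x ∈ V i) ∧
      (∀ s ∈ t, ∀ s' ∈ t, ∀ i j, (q i).natDegree ≠ 1 → (q j).natDegree ≠ 1 →
        increment (q i) (ipSum n (A s)) = increment (q j) (ipSum n (A s')) → s = s' ∧ i = j) := by
  classical
  induction t using Finset.induction_on with
  | empty => exact ⟨fun _ => ∅, V, by simp, fun i => ⟨hV i, hVne i⟩, by simp, by simp⟩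
  | insert s t hs ih =>
    obtain ⟨A, W, hA, hW, hWV, hgen⟩ := ih
    have hmixing : IsIPStar {α | ∀ i : {i // (q i).natDegree = 1},
        α ∈ {α | (W i ∩ (T ^ (intEval (q i) (ipSum n α) + s)) ⁻¹' V i).Nonempty}} := by
      refine isIPStar_forall fun ⟨i, hi⟩ => ?_
      obtain ⟨c, hc, hlin⟩ := exists_intEval_eq_mul (hint i) (h0 i) hi
      intro R hR
      obtain ⟨α, hα, x, hxW, hxV⟩ := hmix c hc (W i) ((T ^ s) ⁻¹' V i) (hW i).1 (hW i).2
        ((hV i).preimage (T ^ s).continuous) (preimage_zpow_nonempty T s (hVne i)) R hR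
      refine ⟨α, hα, x, hxW, ?_⟩
      rw [Set.mem_preimage, hlin, add_comm, zpow_add_apply, zpow_mul]
      exact hxV
    -- the values that would let an increment of a nonlinear member occur twice
    let F : Set ℤ := {a | ∃ i : {i // (q i).natDegree ≠ 1}, ∃ b : t × ι,
      increment (q i) a = increment (q b.2) (ipSum n (A b.1))}
    have hdeg : ∀ i, (q i).natDegree ≠ 1 → 1 < (q i).natDegree := fun i hi => by
      have := natDegree_pos_of_eval_zero (h0 i) (hne i)
      omega
    have hF : F.Finite := by
      have : F = ⋃ i : {i // (q i).natDegree ≠ 1}, ⋃ b : t × ι,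
          {a | increment (q i) a = increment (q b.2) (ipSum n (A b.1))} := by
        ext a; simp [F]
      rw [this]
      refine Set.finite_iUnion fun i => Set.finite_iUnion fun b => Set.Subsingleton.finite ?_
      intro a ha a' ha'
      exact increment_injective (hdeg i i.2) (Eq.trans ha (Eq.symm ha'))
    have hmix1 : IsMixingAlong T n := by simpa using hmix 1 one_ne_zero
    obtain ⟨α, hα, hαW, hαF⟩ := (hmixing.inter (hmix1.isIPStar_notMem hF)) R hR
    have hupd : ∀ s' ∈ t, Function.update A s α s' = A s' := fun s' hs' =>
      Function.update_of_ne (fun h : s' = s => hs (h ▸ hs')) _ _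
    have hnew : ∀ s' ∈ t, ∀ i j, (q i).natDegree ≠ 1 →
        increment (q i) (ipSum n α) ≠ increment (q j) (ipSum n (A s')) := fun s' hs' i j hi h =>
      hαF ⟨⟨i, hi⟩, (⟨s', hs'⟩, j), h⟩
    refine ⟨Function.update A s α, fun i => if (q i).natDegree = 1 then
      W i ∩ (T ^ (intEval (q i) (ipSum n α) + s)) ⁻¹' V i else W i, ?_, ?_, ?_, ?_⟩
    · intro s' hs'
      rcases Finset.mem_insert.1 hs' with rfl | hs'
      · rwa [Function.update_self]
      · rw [hupd s' hs']; exact hA s' hs'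
    · intro i
      dsimp only
      split_ifs with hi
      · exact ⟨(hW i).1.inter ((hV i).preimage (T ^ _).continuous), hαW ⟨i, hi⟩⟩
      · exact hW i
    · intro s' hs' i hi x hx
      simp only [if_pos hi] at hx
      rcases Finset.mem_insert.1 hs' with rfl | hs'
      · rw [Function.update_self]; exact hx.2
      · rw [hupd s' hs']; exact hWV s' hs' i hi x hx.1
    · intro s₁ hs₁ s₂ hs₂ i j hi hj h
      rcases Finset.mem_insert.1 hs₁ with rfl | h₁ <;>
        rcases Finset.mem_insert.1 hs₂ with rfl | h₂
      · exact ⟨rfl, hq (eq_of_increment_eq (h0 i) (h0 j) h)⟩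
      · rw [Function.update_self, hupd _ h₂] at h
        exact absurd h (hnew _ h₂ i j hi)
      · rw [Function.update_self, hupd _ h₁] at h
        exact absurd h.symm (hnew _ h₁ j i hj)
      · rw [hupd _ h₁, hupd _ h₂] at h
        exact hgen _ h₁ _ h₂ i j hi hj h

/-- The theorem for pairwise distinct nonzero polynomials without constant term, by PET induction on
the weight of the family. -/
theorem isIPStar_nonempty_inter {X : Type*} [TopologicalSpace X] [T2Space X] [CompactSpace X]
    [Nontrivial X] {T : X ≃ₜ X} {n : ℕ → ℤ} (hmin : IsMinimalSystem T)
    (hmix : ∀ k : ℤ, k ≠ 0 → IsMixingAlong (T ^ k) n) (w : Multiset ℕ) :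
    ∀ {ι : Type} [Finite ι] (q : ι → ℚ[X]), petWeight q = w → Function.Injective q →
      (∀ i, IsIntegerValued (q i)) → (∀ i, (q i).eval 0 = 0) → (∀ i, q i ≠ 0) →
      ∀ (U : Set X) (V : ι → Set X), IsOpen U → U.Nonempty → (∀ i, IsOpen (V i)) →
        (∀ i, (V i).Nonempty) →
        IsIPStar {α | (U ∩ ⋂ i, (T ^ intEval (q i) (ipSum n α)) ⁻¹' V i).Nonempty} := by
  classical
  induction w using (Multiset.wellFounded_isDershowitzMannaLT (α := ℕ)).induction with
  | _ w ih =>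
  intro ι _ q hw hq hint h0 hne U V hU hUne hV hVne R hR
  rcases isEmpty_or_nonempty ι with _ | ⟨⟨i₀⟩⟩
  · obtain ⟨α, hα⟩ := hR.nonempty
    exact ⟨α, hα, by simpa using hUne⟩
  obtain ⟨t, ht⟩ := hmin.exists_finset_cover hU hUne
  obtain ⟨s₀, hs₀, -⟩ := ht hUne.some
  obtain ⟨A, W, hA, hW, hWV, hgen⟩ := exists_generic_times hmix hq hint h0 hne hV hVne hR t
  -- the linear members once each, and all the increments of the nonlinear ones
  let κ := {i // (q i).natDegree = 1} ⊕ ({i // (q i).natDegree ≠ 1} × t)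
  let Q : κ → ℚ[X] := Sum.elim (fun i => q i) fun b => increment (q b.1) (ipSum n (A b.2))
  let V' : κ → Set X := Sum.elim (fun i => W i) fun b =>
    (T ^ (intEval (q b.1) (ipSum n (A b.2)) + b.2)) ⁻¹' V b.1
  have hdeg : ∀ i, 0 < (q i).natDegree := fun i => natDegree_pos_of_eval_zero (h0 i) (hne i)
  have hQ : Function.Injective Q := by
    rintro (i | ⟨i, s⟩) (j | ⟨j, s'⟩) h
    · exact congrArg Sum.inl (Subtype.ext (hq h))
    · refine absurd (congrArg natDegree h) ?_
      simp only [Q, Sum.elim_inl, Sum.elim_inr, natDegree_increment]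
      exact fun h => j.2 (h ▸ i.2)
    · refine absurd (congrArg natDegree h) ?_
      simp only [Q, Sum.elim_inl, Sum.elim_inr, natDegree_increment]
      exact fun h => i.2 (h ▸ j.2)
    · obtain ⟨h1, h2⟩ := hgen s s.2 s' s'.2 i j i.2 j.2 h
      rw [Subtype.ext h1, Subtype.ext h2]
  have hQint : ∀ k, IsIntegerValued (Q k) := by
    rintro (i | ⟨i, s⟩)
    exacts [hint i, (hint i).increment _]
  have hQ0 : ∀ k, (Q k).eval 0 = 0 := by
    rintro (i | ⟨i, s⟩)
    exacts [h0 i, increment_eval_zero _ _]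
  have hQw : petWeight Q = w := by
    have : leadingData Q = leadingData q := by
      ext x
      rw [mem_leadingData, mem_leadingData]
      constructor
      · rintro ⟨i | ⟨i, s⟩, rfl⟩
        · exact ⟨i, rfl⟩
        · exact ⟨i, by simp only [Q, Sum.elim_inr, natDegree_increment,
            leadingCoeff_increment (hdeg i)]⟩
      · rintro ⟨i, rfl⟩
        by_cases hi : (q i).natDegree = 1
        · exact ⟨Sum.inl ⟨i, hi⟩, rfl⟩
        · exact ⟨Sum.inr (⟨i, hi⟩, ⟨s₀, hs₀⟩), by simp only [Q, Sum.elim_inr, natDegree_increment,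
            leadingCoeff_increment (hdeg i)]⟩
    rw [← hw, petWeight, petWeight, this]
  have hV' : ∀ k, IsOpen (V' k) ∧ (V' k).Nonempty := by
    rintro (i | ⟨i, s⟩)
    · exact hW i
    · exact ⟨(hV i).preimage (T ^ _).continuous, preimage_zpow_nonempty T _ (hVne i)⟩
  have : Nonempty κ := by
    by_cases hi : (q i₀).natDegree = 1
    · exact ⟨Sum.inl ⟨i₀, hi⟩⟩
    · exact ⟨Sum.inr (⟨i₀, hi⟩, ⟨s₀, hs₀⟩)⟩
  obtain ⟨o, ho⟩ := Finite.exists_min fun k => (Q k).natDegree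
  have hstar := ih _ (hQw ▸ petWeight_sub_lt hQ ho) (fun k : {k // k ≠ o} => Q k - Q o) rfl
    (fun k l h => Subtype.ext (hQ (sub_left_injective h)))
    (fun k => (hQint k).sub (hQint o)) (fun k => by rw [eval_sub, hQ0, hQ0, sub_zero])
    (fun k => sub_ne_zero.2 fun h => k.2 (hQ h)) (V' o) (fun k => V' k) (hV' o).1 (hV' o).2
    (fun k => (hV' k).1) (fun k => (hV' k).2)
  obtain ⟨α, hα, ⟨z, hzo, hz⟩, hbefore⟩ :=
    (hstar.inter (isIPStar_biInter t fun s _ => isIPStar_before (A s))) R hR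
  set m := ipSum n α with hm
  set x := (T ^ (-intEval (Q o) m)) z with hx
  have hxV' : ∀ k, (T ^ intEval (Q k) m) x ∈ V' k := by
    intro k
    by_cases hk : k = o
    · rwa [hk, hx, zpow_neg_apply]
    · have := Set.mem_iInter.1 hz ⟨k, hk⟩
      rw [Set.mem_preimage, intEval_sub (hQint k) (hQint o)] at this
      rwa [hx, ← zpow_add_apply, ← sub_eq_add_neg]
  obtain ⟨s, hs, hsU⟩ := ht x
  have hsum : ipSum n (A s ∪ α) = ipSum n (A s) + m := ipSum_union n (hbefore s hs)
  refine ⟨A s ∪ α, hR.union_mem (hA s hs) hα, (T ^ s) x, hsU, Set.mem_iInter.2 fun i => ?_⟩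
  rw [Set.mem_preimage, hsum, ← zpow_add_apply]
  by_cases hi : (q i).natDegree = 1
  · obtain ⟨c, -, hc⟩ := exists_intEval_eq_mul (hint i) (h0 i) hi
    have h1 := hWV s hs i hi _ (hxV' (Sum.inl ⟨i, hi⟩))
    rw [← zpow_add_apply] at h1
    convert h1 using 3
    change _ = intEval (q i) (ipSum n (A s)) + s + intEval (q i) m
    rw [hc, hc, hc]
    ring
  · have h1 := hxV' (Sum.inr (⟨i, hi⟩, ⟨s, hs⟩))
    change (T ^ (intEval (q i) (ipSum n (A s)) + s)) _ ∈ V i at h1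
    rw [← zpow_add_apply] at h1
    convert h1 using 3
    change _ = _ + intEval (increment (q i) (ipSum n (A s))) m
    rw [intEval_increment (hint i), add_comm m]
    ring

end IPMixing

theorem theorem3p3 {X : Type*} [MetricSpace X] [CompactSpace X] (T : X ≃ₜ X) (n : ℕ → ℤ)
    (hmin : IPMixing.IsMinimalSystem T)
    (hmix : ∀ k : ℤ, k ≠ 0 → IPMixing.IsMixingAlong (T ^ k) n)
    (d : ℕ) (p : Fin d → ℤ → ℤ)
    (hp : ∀ i, IPMixing.IsIntegralPolynomial (p i))
    (hconst : ∀ i, ¬ IPMixing.IsConstant (p i))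
    (hdiff : ∀ i j, i ≠ j → ¬ IPMixing.IsConstant (fun m => p i m - p j m)) :
    IPMixing.IsDeltaTransitive (fun i m => T ^ p i m) n ∧
    ∀ (U : Set X) (V : Fin d → Set X), IsOpen U → U.Nonempty →
      (∀ i, IsOpen (V i)) → (∀ i, (V i).Nonempty) →
      {m : ℤ | (U ∩ ⋂ i, (T ^ p i m) ⁻¹' V i).Nonempty} ∈
        IPMixing.dualFamily (IPMixing.ipFamily n) := by
  open IPMixing in
  have main : IsDeltaTransitive (fun i m => T ^ p i m) n := by
    intro U V hU hUne hV hVne α₀ _ R hR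
    rcases subsingleton_or_nontrivial X with _ | _
    · obtain ⟨α, hα, hb⟩ := hR.exists_before α₀
      obtain ⟨u, hu⟩ := hUne
      refine ⟨α, hα, hb, u, hu, Set.mem_iInter.2 fun i => ?_⟩
      obtain ⟨v, hv⟩ := hVne i
      rwa [Set.mem_preimage, Subsingleton.elim ((T ^ p i (ipSum n α)) u) v]
    choose P hP using hp
    -- subtract the constant terms, which only translate the target sets
    let q : Fin d → Polynomial ℚ := fun i => P i - Polynomial.C ((p i 0 : ℤ) : ℚ)
    have hqval : ∀ i (m : ℤ), (q i).eval (m : ℚ) = ((p i m - p i 0 : ℤ) : ℚ) := fun i m => by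
      simp only [q, Polynomial.eval_sub, Polynomial.eval_C, ← hP, Int.cast_sub]
    have hint : ∀ i, IsIntegerValued (q i) := fun i m => ⟨_, hqval i m⟩
    have hev : ∀ i m, intEval (q i) m = p i m - p i 0 := fun i m => by
      rw [intEval, hqval, Int.floor_intCast]
    have hq : Function.Injective q := by
      intro i j hij
      by_contra hne
      refine hdiff i j hne ⟨p i 0 - p j 0, fun m => ?_⟩
      have := hev i m
      rw [hij, hev j m] at this
      change p i m - p j m = _
      omega
    have h0 : ∀ i, (q i).eval 0 = 0 := fun i => by simpa using hqval i 0
    have hne : ∀ i, q i ≠ 0 := by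
      intro i h
      refine hconst i ⟨p i 0, fun m => ?_⟩
      have := hev i m
      rw [h] at this
      simp only [intEval, Polynomial.eval_zero, Int.floor_zero] at this
      omega
    obtain ⟨α, hα, ⟨x, hxU, hx⟩, hb⟩ :=
      ((isIPStar_nonempty_inter hmin hmix _ q rfl hq hint h0 hne U
        (fun i => (T ^ p i 0) ⁻¹' V i) hU hUne (fun i => (hV i).preimage (T ^ _).continuous)
        (fun i => preimage_zpow_nonempty T _ (hVne i))).inter (isIPStar_before α₀)) R hR
    refine ⟨α, hα, hb, x, hxU, Set.mem_iInter.2 fun i => ?_⟩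
    have h1 := Set.mem_iInter.1 hx i
    rw [Set.mem_preimage, Set.mem_preimage, ← zpow_add_apply, hev, add_sub_cancel] at h1
    exact h1
  refine ⟨main, fun U V hU hUne hV hVne B hB => ?_⟩
  obtain ⟨R, hR, hRB⟩ := hB
  obtain ⟨α, hα, -, h⟩ := main U V hU hUne hV hVne {0} (by simp) R hR
  exact ⟨_, h, hRB ⟨α, hα, rfl⟩⟩
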